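/- **Model.** Fix an integer $K\ge 2$ and constants $A,B,\tau>0$ with $KA\le B<1$ and $\tau\le(1-B)/K$. Let $\mathcal A$ be a measurable space carrying a probability measure $\mathcal Q$. For each $u\in\mathcal A$ let $S_1(u),\dots,S_K(u)$ be similarities of $[0,1]$ into itself with scaling ratios $a(i,u)$ (measurable in $u$) such that $A\le a(i,u)$, $\sum_{i}a(i,u)\le B$ and $\operatorname{dist}(S_i(u)[0,1],S_j(u)[0,1])\ge\tau$ for $i\ne j$. Let $\mathcal W=\{p\in\mathbb R^K: p_i\ge 0,\ \sum_i p_i=1\}$. An *independent weight distribution* is a Borel probability measure $\mathcal R$ on $\mathcal W$ with $\int p_i^{-t}\,d\mathcal R(p)<\infty$ for all $i$, for some $t>0$; put $\mathbb P=\mathcal Q\times\mathcal R$ on $\Lambda=\mathcal A\times\mathcal W$, and for $\lambda=(u,p)\in\Lambda$ write $a(i,\lambda)=a(i,u)$, $p(i,\lambda)=p_i$. For $\boldsymbol\lambda=(\boldsymbol\lambda_n)_{n\ge1}\in\Lambda^{\mathbb N}$, with $\boldsymbol\lambda_n=(u_n,p_n)$, drawn from $\mathbb P^{\mathbb N}$,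 put $I_{i_1\dots i_n}=S_{i_1}(u_1)\circ\dots\circ S_{i_n}(u_n)[0,1]$ and $F_{\boldsymbol\lambda}=\bigcap_n\bigcup_{i_1,\dots,i_n}I_{i_1\dots i_n}$, and let $\mu_{\boldsymbol\lambda}$ be the Borel probability measure on $[0,1]$ with $\mu_{\boldsymbol\lambda}(I_{i_1\dots i_n})=p(i_1,\boldsymbol\lambda_1)\cdots p(i_n,\boldsymbol\lambda_n)$ for all $i_1,\dots,i_n$. Let $D\ge 0$ be the almost sure Hausdorff dimension of $F_{\boldsymbol\lambda}$ (this set depends only on $(u_n)$, whose law is $\mathcal Q^{\mathbb N}$). For $\theta\ge0$ let $m(\theta,\lambda)$ (resp. $m'(\theta,\lambda)$) be the least index at which $j\mapsto a(j,\lambda)^\theta/p(j,\lambda)$ is maximal (resp. minimal), and $$G(\theta)=\frac{\mathbb E\log p(m(\theta,\lambda),\lambda)}{\mathbb E\log a(m(\theta,\lambda),\lambda)},\qquad G'(\theta)=\frac{\mathbb E\log p(m'(\theta,\lambda),\lambda)}{\mathbb E\log a(m'(\theta,\lambda),\lambda)},$$ where the expectation is over $\lambda\sim\mathbb P$. **Dimensions.**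 A dimension function is a map $\Phi:(0,1)\to[0,\infty)$ such that $t^{1+\Phi(t)}$ decreases to $0$ as $t$ decreases to $0$ and, for some $T,C>0$, $(2t)^{1+\Phi(2t)}\le C\,t^{1+\Phi(t)}$ for all $0<t<T$. It is large if $\Phi(t)=H(t)\,\frac{\log|\log t|}{|\log t|}$ for small $t$, with $H(t)\to\infty$ as $t\to0$. The upper $\Phi$-dimension $\overline{\dim}_\Phi\mu$ of a Borel probability measure $\mu$ is the infimum of the $d$ for which there are $C_1\in(0,1)$ and $C_2>0$ such that $\mu(B(x,R))/\mu(B(x,r))\le C_2(R/r)^d$ for all $0<r<R^{1+\Phi(R)}\le R\le C_1$ and $x\in\operatorname{supp}\mu$; the lower $\Phi$-dimension $\underline{\dim}_\Phi\mu$ is the supremum of the $d$ for which the same holds with $\ge$ in place of $\le$. **Theorem.** Suppose there are an index $i\in\{1,\dots,K\}$ and measurable sets $\Upsilon_1,\Upsilon_2\subseteq\mathcal A$, both of positive $\mathcal Q$-probability, with $$\sup_{u\in\Upsilon_1}\frac{a(i,u)^D}{\sum_{\ell=1}^Ka(\ell,u)^D}<\inf_{u\in\Upsilon_2}\frac{a(i,u)^D}{\sum_{\ell=1}^Ka(\ell,u)^D}.$$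 Then there are $\delta_1,\delta_2>0$ such that for every independent weight distribution $\mathcal R$, $$G(D)-D>\delta_1\quad\text{and}\quad D-G'(D)>\delta_2,$$ and, almost surely, $\overline{\dim}_\Phi\mu_{\boldsymbol\lambda}>D+\delta_1$ and $\underline{\dim}_\Phi\mu_{\boldsymbol\lambda}<D-\delta_2$ for every large dimension function $\Phi$. -/

import Mathlib

open MeasureTheory Filter Topology
open scoped ENNReal unitInterval

noncomputable section

/-! ### Upper and lower `Φ`-dimensions of a measure -/

/-- `Φ : (0,1) → [0,∞)` is a dimension function: `t ^ (1 + Φ t)` decreases to `0` as `t` decreases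
to `0`, and it is doubling near zero. Values of `Φ` outside `(0,1)` are irrelevant. -/
structure IsDimensionFunction (Φ : ℝ → ℝ) : Prop where
  nonneg : ∀ t ∈ Set.Ioo (0 : ℝ) 1, 0 ≤ Φ t
  monotoneOn : MonotoneOn (fun t => t ^ (1 + Φ t)) (Set.Ioo 0 1)
  tendsto_zero : Tendsto (fun t => t ^ (1 + Φ t)) (𝓝[>] 0) (𝓝 0)
  doubling : ∃ T > 0, ∃ C > 0, T ≤ 1 / 2 ∧
    ∀ t, 0 < t → t < T → (2 * t) ^ (1 + Φ (2 * t)) ≤ C * t ^ (1 + Φ t)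

/-- `Φ` is large: `Φ t = H t * log |log t| / |log t|` near zero, where `H t → ∞` as `t → 0⁺`. -/
def IsLargeDimensionFunction (Φ : ℝ → ℝ) : Prop :=
  ∃ H : ℝ → ℝ, Tendsto H (𝓝[>] 0) atTop ∧
    ∀ᶠ t in 𝓝[>] (0 : ℝ), Φ t = H t * (Real.log |Real.log t| / |Real.log t|)

/-- The upper `Φ`-dimension of a measure, as an extended real number. -/
def upperPhiDim {X : Type*} [MetricSpace X] [MeasurableSpace X] (Φ : ℝ → ℝ) (μ : Measure X) :
    EReal :=
  sInf ((fun d : ℝ => (d : EReal)) '' {d : ℝ | ∃ C₁ C₂ : ℝ, 0 < C₁ ∧ C₁ < 1 ∧ 0 < C₂ ∧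
    ∀ r R : ℝ, 0 < r → r < R ^ (1 + Φ R) → R ^ (1 + Φ R) ≤ R → R ≤ C₁ → ∀ x ∈ μ.support,
      μ.real (Metric.ball x R) / μ.real (Metric.ball x r) ≤ C₂ * (R / r) ^ d})

/-- The lower `Φ`-dimension of a measure, as an extended real number. -/
def lowerPhiDim {X : Type*} [MetricSpace X] [MeasurableSpace X] (Φ : ℝ → ℝ) (μ : Measure X) :
    EReal :=
  sSup ((fun d : ℝ => (d : EReal)) '' {d : ℝ | ∃ C₁ C₂ : ℝ, 0 < C₁ ∧ C₁ < 1 ∧ 0 < C₂ ∧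
    ∀ r R : ℝ, 0 < r → r < R ^ (1 + Φ R) → R ^ (1 + Φ R) ≤ R → R ≤ C₁ → ∀ x ∈ μ.support,
      C₂ * (R / r) ^ d ≤ μ.real (Metric.ball x R) / μ.real (Metric.ball x r)})

/-! ### The random model -/

/-- A family, indexed by `u : 𝒜`, of uniformly strongly separated iterated function systems
`S 1 u, …, S K u` of similarities of `[0,1]`, where `S i u` has scaling ratio `a i u`. -/
structure MoranFamily (K : ℕ) (𝒜 : Type*) [MeasurableSpace 𝒜] where
  A : ℝ
  B : ℝ
  τ : ℝ
  two_le : 2 ≤ K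
  A_pos : 0 < A
  mul_A_le : K * A ≤ B
  B_lt_one : B < 1
  τ_pos : 0 < τ
  τ_le : τ ≤ (1 - B) / K
  S : Fin K → 𝒜 → I → I
  a : Fin K → 𝒜 → ℝ
  similarity : ∀ i u x y, dist (S i u x) (S i u y) = a i u * dist x y
  A_le : ∀ i u, A ≤ a i u
  sum_le : ∀ u, ∑ i, a i u ≤ B
  separated : ∀ i j u x y, i ≠ j → τ ≤ dist (S i u x) (S j u y)
  measurable_a : ∀ i, Measurable (a i)

/-- The set of all probability weight vectors with `K` components. -/
abbrev Weights (K : ℕ) : Type := stdSimplex ℝ (Fin K)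

/-- The measure on `{1, …, K}` giving mass `v i` to `i`. -/
def weightMeasure {K : ℕ} (v : Weights K) : Measure (Fin K) :=
  ∑ i, ENNReal.ofReal (v i) • Measure.dirac i

theorem weightMeasure_singleton {K : ℕ} (v : Weights K) (i : Fin K) :
    weightMeasure v {i} = ENNReal.ofReal (v i) := by
  simp [weightMeasure, Set.indicator_apply]

instance isProbabilityMeasure_weightMeasure {K : ℕ} (v : Weights K) :
    IsProbabilityMeasure (weightMeasure v) := by
  constructor
  have h : ∑ i, v i = 1 := v.2.2
  simp only [weightMeasure, Measure.coe_finsetSum, Finset.sum_apply, Measure.smul_apply,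
    measure_univ, smul_eq_mul, mul_one]
  rw [← ENNReal.ofReal_sum_of_nonneg (f := fun i => v i) (fun i _ => v.2.1 i)]
  exact ENNReal.ofReal_eq_one.2 h

/-- The standing integrability condition on the distribution of the weights: for some `t > 0`, the
expectation of `p i ^ (-t)` is finite for every `i` (with `0 ^ (-t) = ∞`). -/
def IsAdmissible {K : ℕ} (ρ : Measure (Weights K)) : Prop :=
  ∃ t : ℝ, 0 < t ∧ ∀ i, ∫⁻ v, ENNReal.ofReal (v i) ^ (-t) ∂ρ < ∞

namespace MoranFamily

variable {K : ℕ} {𝒜 : Type*} [MeasurableSpace 𝒜] (M : MoranFamily K 𝒜)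

/-- The composition `S (i 0) (u 0) ∘ ⋯ ∘ S (i (n-1)) (u (n-1))`. -/
def comp (u : ℕ → 𝒜) (i : ℕ → Fin K) : ℕ → I → I
  | 0 => id
  | n + 1 => comp u i n ∘ M.S (i n) (u n)

/-- The step `n` Moran interval given by the first `n` letters of `i`. -/
def interval (u : ℕ → 𝒜) (i : ℕ → Fin K) (n : ℕ) : Set I := Set.range (M.comp u i n)

/-- The random Moran set. -/
def moranSet (u : ℕ → 𝒜) : Set I := ⋂ n, ⋃ i : ℕ → Fin K, M.interval u i n

/-- The point of the Moran set with address `i`, that is, the unique common point of the Moran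
intervals `M.interval u i n`. -/
def coding (u : ℕ → 𝒜) (i : ℕ → Fin K) : I := limUnder atTop (fun n => M.comp u i n 0)

/-- The random measure: the image of the product of the weight vectors under the coding map. By
`randomMeasure_interval` it gives every Moran interval the product of the weights of its letters. -/
def randomMeasure (u : ℕ → 𝒜) (v : ℕ → Weights K) : Measure I :=
  (Measure.infinitePi fun n => weightMeasure (v n)).map (M.coding u)

theorem a_pos (i : Fin K) (u : 𝒜) : 0 < M.a i u := M.A_pos.trans_le (M.A_le i u)

theorem a_le (i : Fin K) (u : 𝒜) : M.a i u ≤ M.B :=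
  (Finset.single_le_sum (f := fun j => M.a j u) (fun j _ => (M.a_pos j u).le)
    (Finset.mem_univ i)).trans (M.sum_le u)

theorem B_pos : 0 < M.B := by
  have h : (0 : ℝ) < K := by exact_mod_cast (by have := M.two_le; omega : 0 < K)
  exact (mul_pos h M.A_pos).trans_le M.mul_A_le

theorem dist_comp_le (u : ℕ → 𝒜) (i : ℕ → Fin K) (n : ℕ) (x y : I) :
    dist (M.comp u i n x) (M.comp u i n y) ≤ M.B ^ n * dist x y := by
  induction n generalizing x y with
  | zero => simp [comp]
  | succ n ih =>
    refine (ih _ _).trans ?_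
    rw [M.similarity, pow_succ, mul_assoc]
    have := M.B_pos
    gcongr
    exact M.a_le _ _

theorem injective_comp (u : ℕ → 𝒜) (i : ℕ → Fin K) (n : ℕ) :
    Function.Injective (M.comp u i n) := by
  induction n with
  | zero => exact Function.injective_id
  | succ n ih =>
    refine ih.comp fun x y h => ?_
    have h1 := M.similarity (i n) (u n) x y
    rw [h, dist_self] at h1
    have := (M.a_pos (i n) (u n)).ne'
    exact dist_eq_zero.1 ((mul_eq_zero.1 h1.symm).resolve_left this)

theorem comp_congr (u : ℕ → 𝒜) {i j : ℕ → Fin K} {n : ℕ} (h : ∀ k < n, i k = j k) :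
    M.comp u i n = M.comp u j n := by
  induction n with
  | zero => rfl
  | succ n ih =>
    simp only [comp]
    rw [ih fun k hk => h k (by omega), h n (by omega)]

theorem eq_of_comp_eq (u : ℕ → 𝒜) {i j : ℕ → Fin K} {n : ℕ} {x y : I}
    (h : M.comp u i n x = M.comp u j n y) : ∀ k < n, i k = j k := by
  induction n generalizing x y with
  | zero => intro k hk; omega
  | succ n ih =>
    have h0 := ih (x := M.S (i n) (u n) x) (y := M.S (j n) (u n) y) h
    have h1 : M.comp u i n (M.S (i n) (u n) x) = M.comp u i n (M.S (j n) (u n) y) := by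
      have h' : M.comp u i n (M.S (i n) (u n) x) = M.comp u j n (M.S (j n) (u n) y) := h
      rwa [← M.comp_congr u h0] at h'
    have h2 := M.injective_comp u i n h1
    have h3 : i n = j n := by
      by_contra hne
      have h4 := M.separated (i n) (j n) (u n) x y hne
      rw [h2, dist_self] at h4
      exact absurd M.τ_pos (not_lt.2 h4)
    intro k hk
    rcases Nat.lt_succ_iff_lt_or_eq.1 hk with hk | rfl
    · exact h0 k hk
    · exact h3

theorem comp_mem_interval (u : ℕ → 𝒜) (i : ℕ → Fin K) (n k : ℕ) (x : I) :
    M.comp u i (n + k) x ∈ M.interval u i n := by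
  induction k generalizing x with
  | zero => exact ⟨x, rfl⟩
  | succ k ih => exact ih (M.S (i (n + k)) (u (n + k)) x)

theorem isClosed_interval (u : ℕ → 𝒜) (i : ℕ → Fin K) (n : ℕ) : IsClosed (M.interval u i n) := by
  have hc : Continuous (M.comp u i n) := by
    have := M.B_pos
    exact (LipschitzWith.of_dist_le_mul (K := ⟨M.B ^ n, by positivity⟩)
      (M.dist_comp_le u i n)).continuous
  exact (isCompact_range hc).isClosed

theorem tendsto_coding (u : ℕ → 𝒜) (i : ℕ → Fin K) :
    Tendsto (fun n => M.comp u i n 0) atTop (𝓝 (M.coding u i)) := by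
  refine CauchySeq.tendsto_limUnder (cauchySeq_of_le_geometric M.B 1 M.B_lt_one fun n => ?_)
  refine (M.dist_comp_le u i n _ _).trans ?_
  have := M.B_pos
  rw [one_mul]
  refine mul_le_of_le_one_right (by positivity) ?_
  have h0 := (0 : I).2
  have h1 := (M.S (i n) (u n) 0).2
  rw [Subtype.dist_eq, Real.dist_eq, abs_le]
  constructor <;> linarith [h0.1, h0.2, h1.1, h1.2]

theorem coding_mem_interval (u : ℕ → 𝒜) (i : ℕ → Fin K) (n : ℕ) :
    M.coding u i ∈ M.interval u i n := by
  refine (M.isClosed_interval u i n).mem_of_tendsto (M.tendsto_coding u i) ?_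
  filter_upwards [eventually_ge_atTop n] with m hm
  obtain ⟨k, rfl⟩ := Nat.exists_eq_add_of_le hm
  exact M.comp_mem_interval u i n k 0

theorem coding_mem_moranSet (u : ℕ → 𝒜) (i : ℕ → Fin K) : M.coding u i ∈ M.moranSet u :=
  Set.mem_iInter.2 fun n => Set.mem_iUnion.2 ⟨i, M.coding_mem_interval u i n⟩

theorem measurable_comp (u : ℕ → 𝒜) (n : ℕ) (x : I) :
    Measurable fun i : ℕ → Fin K => M.comp u i n x := by
  induction n generalizing x with
  | zero => exact measurable_const
  | succ n ih =>
    have h : Measurable fun q : (ℕ → Fin K) × Fin K => M.comp u q.1 n (M.S q.2 (u n) x) :=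
      measurable_from_prod_countable_left fun k => ih (M.S k (u n) x)
    exact h.comp (measurable_id.prodMk (measurable_pi_apply n))

theorem measurable_coding (u : ℕ → 𝒜) : Measurable (M.coding u) :=
  measurable_of_tendsto_metrizable (fun n => M.measurable_comp u n 0)
    (tendsto_pi_nhds.2 fun i => M.tendsto_coding u i)

theorem randomMeasure_interval (u : ℕ → 𝒜) (v : ℕ → Weights K) (i : ℕ → Fin K) (n : ℕ) :
    M.randomMeasure u v (M.interval u i n) =
      ∏ k ∈ Finset.range n, ENNReal.ofReal (v k (i k)) := by
  have h : M.coding u ⁻¹' M.interval u i n =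
      Set.pi (Finset.range n : Finset ℕ) fun k => {i k} := by
    ext j
    simp only [Set.mem_preimage, Set.mem_pi, Finset.coe_range, Set.mem_Iio,
      Set.mem_singleton_iff]
    constructor
    · rintro ⟨y, hy⟩
      obtain ⟨x, hx⟩ := M.coding_mem_interval u j n
      exact M.eq_of_comp_eq u (hx.trans hy.symm)
    · intro hj
      have := M.coding_mem_interval u j n
      rwa [interval, M.comp_congr u hj] at this
  rw [randomMeasure, Measure.map_apply (M.measurable_coding u)
    (M.isClosed_interval u i n).measurableSet, h,
    Measure.infinitePi_pi _ fun _ _ => measurableSet_singleton _]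
  exact Finset.prod_congr rfl fun k _ => weightMeasure_singleton _ _

/-- The natural weight `a i u ^ D / ∑ ℓ, a ℓ u ^ D`. -/
def naturalWeight (D : ℝ) (i : Fin K) (u : 𝒜) : ℝ := M.a i u ^ D / ∑ ℓ, M.a ℓ u ^ D

/-! ### The functions `G` and `G'` -/

/-- The quotient `a j ^ θ / p j`. -/
def ratio (θ : ℝ) (l : 𝒜 × Weights K) (j : Fin K) : ℝ := M.a j l.1 ^ θ / l.2 j

theorem exists_max (θ : ℝ) (l : 𝒜 × Weights K) :
    (Finset.univ.filter fun k => ∀ j, M.ratio θ l j ≤ M.ratio θ l k).Nonempty := by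
  have : Nonempty (Fin K) := ⟨⟨0, by have := M.two_le; omega⟩⟩
  obtain ⟨k, hk⟩ := Finite.exists_max (M.ratio θ l)
  exact ⟨k, by simpa using hk⟩

theorem exists_min (θ : ℝ) (l : 𝒜 × Weights K) :
    (Finset.univ.filter fun k => ∀ j, M.ratio θ l k ≤ M.ratio θ l j).Nonempty := by
  have : Nonempty (Fin K) := ⟨⟨0, by have := M.two_le; omega⟩⟩
  obtain ⟨k, hk⟩ := Finite.exists_min (M.ratio θ l)
  exact ⟨k, by simpa using hk⟩

/-- `m θ l` is the minimal index at which `a j ^ θ / p j` is maximal. -/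
def m (θ : ℝ) (l : 𝒜 × Weights K) : Fin K :=
  (Finset.univ.filter fun k => ∀ j, M.ratio θ l j ≤ M.ratio θ l k).min' (M.exists_max θ l)

/-- `m' θ l` is the minimal index at which `a j ^ θ / p j` is minimal. -/
def m' (θ : ℝ) (l : 𝒜 × Weights K) : Fin K :=
  (Finset.univ.filter fun k => ∀ j, M.ratio θ l k ≤ M.ratio θ l j).min' (M.exists_min θ l)

/-- `G θ = 𝔼 (log p (m θ)) / 𝔼 (log a (m θ))`. -/
def G (P : Measure (𝒜 × Weights K)) (θ : ℝ) : ℝ :=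
  (∫ l, Real.log (l.2 (M.m θ l)) ∂P) / ∫ l, Real.log (M.a (M.m θ l) l.1) ∂P

/-- `G' θ = 𝔼 (log p (m' θ)) / 𝔼 (log a (m' θ))`. -/
def G' (P : Measure (𝒜 × Weights K)) (θ : ℝ) : ℝ :=
  (∫ l, Real.log (l.2 (M.m' θ l)) ∂P) / ∫ l, Real.log (M.a (M.m' θ l) l.1) ∂P

end MoranFamily

end

/-!
Let `φ θ = 𝔼 log ∑ ℓ, a ℓ ^ θ`. By the strong law of large numbers the product over `k < n` of the
sums `∑ ℓ, a ℓ (u k) ^ θ` behaves like `exp (n φ θ)`. If `φ θ < 0`, covering the Moran set by its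
step `n` intervals bounds its dimension by `θ`; if `φ θ > 0`, the random measure with natural weights
`a i ^ θ / ∑ ℓ, a ℓ ^ θ` and the mass distribution principle bound it below by `θ`. Since `φ` is
continuous, the almost sure dimension `D` satisfies `φ D = 0`
(`MoranFamily.integral_log_powerSum_eq_zero`).

Write `q i = a i ^ D / ∑ ℓ, a ℓ ^ D`. As `𝔼 log q (e) = D 𝔼 log a (e)` for every random digit `e`,
the gap `G D - D` equals `𝔼 log (q m / p m) / |𝔼 log a m|`, and `m` maximizes `q j / p j`. The
numerator is nonnegative since both `p` and `q` sum to one, and it is bounded away from zero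
uniformly in the law of `p`: choose `c` between the supremum of `q i` on `Υ₁` and its infimum on
`Υ₂`. Since `p` is independent of the environment, with probability at least `min (Q Υ₁) (Q Υ₂)`
either `p i ≤ c` in an environment in `Υ₂`, or `p i > c` in an environment in `Υ₁`
(`MoranFamily.min_le_measureReal_mismatch`), and then `q m / p m` is at least a constant larger than
one (`cross_mul_le`). The gap `D - G' D` is treated in the same way with `p` and `q` exchanged.

For the `Φ`-dimensions, follow the digits `m` (or `m'`) forever. The resulting point lies in the
support and has local dimension `G D` (or `G' D`) by the law of large numbers
(`MoranFamily.ae_phiDim_of_digit`). In the definition of the `Φ`-dimensions one may fix `R` and let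
`r` tend to zero, so the upper dimension is at least, and the lower dimension at most, any such
local dimension (`MoranFamily.le_upperPhiDim`, `MoranFamily.lowerPhiDim_le`). This holds
simultaneously for all dimension functions `Φ`, because the exceptional null set comes only from the
law of large numbers and from the almost sure positivity of the weights.
-/

noncomputable section

namespace MoranFamily

variable {K : ℕ} {𝒜 : Type*} [MeasurableSpace 𝒜] (M : MoranFamily K 𝒜)

/-! ### Geometry of the Moran intervals -/

/-- The scaling ratio of `M.comp u i n`, that is, the length of the interval `M.interval u i n`. -/
def contraction (u : ℕ → 𝒜) (i : ℕ → Fin K) (n : ℕ) : ℝ :=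
  ∏ k ∈ Finset.range n, M.a (i k) (u k)

theorem contraction_pos (u : ℕ → 𝒜) (i : ℕ → Fin K) (n : ℕ) : 0 < M.contraction u i n :=
  Finset.prod_pos fun _ _ => M.a_pos _ _

theorem contraction_succ (u : ℕ → 𝒜) (i : ℕ → Fin K) (n : ℕ) :
    M.contraction u i (n + 1) = M.contraction u i n * M.a (i n) (u n) :=
  Finset.prod_range_succ _ _

theorem contraction_antitone (u : ℕ → 𝒜) (i : ℕ → Fin K) : Antitone (M.contraction u i) :=
  antitone_nat_of_succ_le fun n => by
    rw [contraction_succ]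
    exact mul_le_of_le_one_right (M.contraction_pos u i n).le
      ((M.a_le _ _).trans M.B_lt_one.le)

theorem contraction_le (u : ℕ → 𝒜) (i : ℕ → Fin K) (n : ℕ) : M.contraction u i n ≤ M.B ^ n :=
  (Finset.prod_le_prod (fun _ _ => (M.a_pos _ _).le) fun _ _ => M.a_le _ _).trans (by simp)

theorem tendsto_contraction (u : ℕ → 𝒜) (i : ℕ → Fin K) :
    Tendsto (M.contraction u i) atTop (𝓝 0) :=
  squeeze_zero (fun n => (M.contraction_pos u i n).le) (M.contraction_le u i)
    (tendsto_pow_atTop_nhds_zero_of_lt_one M.B_pos.le M.B_lt_one)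

theorem log_contraction (u : ℕ → 𝒜) (i : ℕ → Fin K) (n : ℕ) :
    Real.log (M.contraction u i n) = ∑ k ∈ Finset.range n, Real.log (M.a (i k) (u k)) :=
  Real.log_prod fun _ _ => (M.a_pos _ _).ne'

theorem dist_comp (u : ℕ → 𝒜) (i : ℕ → Fin K) (n : ℕ) (x y : I) :
    dist (M.comp u i n x) (M.comp u i n y) = M.contraction u i n * dist x y := by
  induction n generalizing x y with
  | zero => simp [comp, contraction]
  | succ n ih =>
    rw [contraction_succ, mul_assoc, ← M.similarity]
    exact ih _ _

theorem dist_le_of_mem_interval {u : ℕ → 𝒜} {i : ℕ → Fin K} {n : ℕ} {x y : I}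
    (hx : x ∈ M.interval u i n) (hy : y ∈ M.interval u i n) :
    dist x y ≤ M.contraction u i n := by
  obtain ⟨x, rfl⟩ := hx
  obtain ⟨y, rfl⟩ := hy
  rw [dist_comp]
  refine mul_le_of_le_one_right (M.contraction_pos u i n).le ?_
  exact Real.dist_le_of_mem_Icc_01 x.2 y.2

theorem interval_congr (u : ℕ → 𝒜) {i j : ℕ → Fin K} {n : ℕ} (h : ∀ k < n, i k = j k) :
    M.interval u i n = M.interval u j n := by
  rw [interval, interval, M.comp_congr u h]

/-- Points of the Moran set whose addresses separate before step `n` are at distance at least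
`τ` times the length of the step `n` interval. -/
theorem eq_of_dist_coding_lt {u : ℕ → 𝒜} {i j : ℕ → Fin K} {n : ℕ}
    (h : dist (M.coding u i) (M.coding u j) < M.τ * M.contraction u i n) :
    ∀ k < n, i k = j k := by
  by_contra! hne
  have hex : ∃ k, i k ≠ j k := hne.imp fun k hk => hk.2
  classical
  obtain ⟨k₀, hk₀, hk₀'⟩ := hne
  set k := Nat.find hex
  have hkn : k ≤ n := (Nat.find_min' hex hk₀').trans hk₀.le
  have heq : ∀ l < k, i l = j l := fun l hl => not_not.1 (Nat.find_min hex hl)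
  obtain ⟨x, hx⟩ := M.coding_mem_interval u i (k + 1)
  obtain ⟨y, hy⟩ := M.coding_mem_interval u j (k + 1)
  have hx' : M.comp u i k (M.S (i k) (u k) x) = M.coding u i := hx
  have hy' : M.comp u j k (M.S (j k) (u k) y) = M.coding u j := hy
  rw [← M.comp_congr u heq] at hy'
  rw [← hx', ← hy', dist_comp] at h
  have h1 := M.separated (i k) (j k) (u k) x y (Nat.find_spec hex)
  have h2 := M.contraction_antitone u i hkn
  have h3 := M.contraction_pos u i k
  have := M.τ_pos
  nlinarith

theorem randomMeasure_le_interval (u : ℕ → 𝒜) (v : ℕ → Weights K) (i : ℕ → Fin K) (n : ℕ)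
    {s : Set I} (hs : MeasurableSet s)
    (h : ∀ y ∈ s, dist (M.coding u i) y < M.τ * M.contraction u i n) :
    M.randomMeasure u v s ≤ M.randomMeasure u v (M.interval u i n) := by
  rw [randomMeasure, Measure.map_apply (M.measurable_coding u) hs,
    Measure.map_apply (M.measurable_coding u) (M.isClosed_interval u i n).measurableSet]
  refine measure_mono fun j hj => ?_
  rw [Set.mem_preimage, M.interval_congr u (M.eq_of_dist_coding_lt (h _ hj))]
  exact M.coding_mem_interval u j n

instance isProbabilityMeasure_randomMeasure (u : ℕ → 𝒜) (v : ℕ → Weights K) :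
    IsProbabilityMeasure (M.randomMeasure u v) :=
  Measure.isProbabilityMeasure_map (M.measurable_coding u).aemeasurable

theorem randomMeasure_real_interval (u : ℕ → 𝒜) (v : ℕ → Weights K) (i : ℕ → Fin K) (n : ℕ) :
    (M.randomMeasure u v).real (M.interval u i n) = ∏ k ∈ Finset.range n, v k (i k) := by
  rw [Measure.real, randomMeasure_interval, ENNReal.toReal_prod]
  exact Finset.prod_congr rfl fun k _ => ENNReal.toReal_ofReal ((v k).2.1 _)

theorem interval_subset_ball {u : ℕ → 𝒜} {i : ℕ → Fin K} {n : ℕ} {r : ℝ}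
    (h : M.contraction u i n < r) : M.interval u i n ⊆ Metric.ball (M.coding u i) r :=
  fun _ hy => (M.dist_le_of_mem_interval hy (M.coding_mem_interval u i n)).trans_lt h

/-! ### Local dimensions at a single address bound the `Φ`-dimensions -/

section LocalDimension

variable {u : ℕ → 𝒜} {v : ℕ → Weights K} {i : ℕ → Fin K}

theorem randomMeasure_ball_pos (hv : ∀ k, 0 < v k (i k)) {r : ℝ} (hr : 0 < r) :
    0 < (M.randomMeasure u v).real (Metric.ball (M.coding u i) r) := by
  obtain ⟨n, hn⟩ := ((M.tendsto_contraction u i).eventually_lt_const hr).exists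
  refine lt_of_lt_of_le ?_ (measureReal_mono (M.interval_subset_ball hn))
  rw [randomMeasure_real_interval]
  exact Finset.prod_pos fun k _ => hv k

theorem coding_mem_support (hv : ∀ k, 0 < v k (i k)) :
    M.coding u i ∈ (M.randomMeasure u v).support := by
  rw [Measure.mem_support_iff_forall]
  intro U hU
  obtain ⟨r, hr, hrU⟩ := Metric.mem_nhds_iff.1 hU
  refine lt_of_lt_of_le ?_ (measure_mono hrU)
  exact (ENNReal.toReal_pos_iff.1 (M.randomMeasure_ball_pos hv hr)).1

/-- The scale `R` is kept fixed while `r` tends to zero along the Moran intervals around the point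
with address `i`; by separation the ball of radius `r = τ * contraction` meets the Moran set only
inside the Moran interval. -/
theorem le_upperPhiDim {Φ : ℝ → ℝ} (hΦ : IsDimensionFunction Φ) (hv : ∀ k, 0 < v k (i k))
    {p α : ℝ} (hα : α < 0)
    (hp : Tendsto (fun n : ℕ => (∑ k ∈ Finset.range n, Real.log (v k (i k))) / n) atTop (𝓝 p))
    (ha : Tendsto (fun n : ℕ => (∑ k ∈ Finset.range n, Real.log (M.a (i k) (u k))) / n) atTop
      (𝓝 α)) :
    ((p / α : ℝ) : EReal) ≤ upperPhiDim Φ (M.randomMeasure u v) := by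
  refine le_sInf ?_
  rintro _ ⟨d, ⟨C₁, C₂, hC₁, hC₁', hC₂, hd⟩, rfl⟩
  rw [EReal.coe_le_coe_iff, div_le_iff_of_neg hα]
  set c := (M.randomMeasure u v).real (Metric.ball (M.coding u i) C₁)
  have hc : 0 < c := M.randomMeasure_ball_pos hv hC₁
  have hpow : 0 < C₁ ^ (1 + Φ C₁) := Real.rpow_pos_of_pos hC₁ _
  have hpow' : C₁ ^ (1 + Φ C₁) ≤ C₁ := by
    have := hΦ.nonneg C₁ ⟨hC₁, hC₁'⟩
    simpa using Real.rpow_le_rpow_of_exponent_ge hC₁ hC₁'.le (show 1 ≤ 1 + Φ C₁ by linarith)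
  have hτ := M.τ_pos
  have hsmall : ∀ᶠ n in atTop, M.τ * M.contraction u i n < C₁ ^ (1 + Φ C₁) := by
    have := (M.tendsto_contraction u i).const_mul M.τ
    rw [mul_zero] at this
    exact this.eventually_lt_const hpow
  have key : ∀ᶠ n : ℕ in atTop,
      d * ((∑ k ∈ Finset.range n, Real.log (M.a (i k) (u k))) / n) ≤
      (Real.log C₂ + d * Real.log (C₁ / M.τ) - Real.log c) / n +
        (∑ k ∈ Finset.range n, Real.log (v k (i k))) / n := by
    filter_upwards [hsmall] with n hn
    have hcon := M.contraction_pos u i n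
    have hr : 0 < M.τ * M.contraction u i n := by positivity
    have h1 := hd _ C₁ hr hn hpow' le_rfl _ (M.coding_mem_support hv)
    have h2 : (M.randomMeasure u v).real
        (Metric.ball (M.coding u i) (M.τ * M.contraction u i n)) ≤
          ∏ k ∈ Finset.range n, v k (i k) := by
      rw [← M.randomMeasure_real_interval u]
      refine ENNReal.toReal_mono (measure_ne_top _ _)
        (M.randomMeasure_le_interval u v i n Metric.isOpen_ball.measurableSet fun y hy => ?_)
      rw [dist_comm]
      exact hy
    have h3 := M.randomMeasure_ball_pos (u := u) hv hr
    have h4 : Real.log c - ∑ k ∈ Finset.range n, Real.log (v k (i k)) ≤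
        Real.log C₂ + d * (Real.log (C₁ / M.τ) -
          ∑ k ∈ Finset.range n, Real.log (M.a (i k) (u k))) := by
      rw [← log_contraction, ← Real.log_prod fun k _ => (hv k).ne',
        ← Real.log_div (by positivity) hcon.ne', ← Real.log_rpow (by positivity),
        ← Real.log_mul hC₂.ne' (by positivity), div_div,
        ← Real.log_div hc.ne' (h3.trans_le h2).ne']
      refine Real.log_le_log (div_pos hc (h3.trans_le h2)) (le_trans ?_ h1)
      gcongr
    rw [← mul_div_assoc, ← add_div]
    gcongr
    linarith
  refine le_of_tendsto_of_tendsto (ha.const_mul d) ?_ key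
  simpa using (tendsto_const_div_atTop_nhds_zero_nat _).add hp

/-- As for `le_upperPhiDim`, with `R` fixed and `r` tending to zero; the factor `2` in the choice of
`r` makes the open ball contain the whole Moran interval. -/
theorem lowerPhiDim_le {Φ : ℝ → ℝ} (hΦ : IsDimensionFunction Φ) (hv : ∀ k, 0 < v k (i k))
    {p α : ℝ} (hα : α < 0)
    (hp : Tendsto (fun n : ℕ => (∑ k ∈ Finset.range n, Real.log (v k (i k))) / n) atTop (𝓝 p))
    (ha : Tendsto (fun n : ℕ => (∑ k ∈ Finset.range n, Real.log (M.a (i k) (u k))) / n) atTop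
      (𝓝 α)) :
    lowerPhiDim Φ (M.randomMeasure u v) ≤ ((p / α : ℝ) : EReal) := by
  refine sSup_le ?_
  rintro _ ⟨d, ⟨C₁, C₂, hC₁, hC₁', hC₂, hd⟩, rfl⟩
  rw [EReal.coe_le_coe_iff, le_div_iff_of_neg hα]
  have hpow : 0 < C₁ ^ (1 + Φ C₁) := Real.rpow_pos_of_pos hC₁ _
  have hpow' : C₁ ^ (1 + Φ C₁) ≤ C₁ := by
    have := hΦ.nonneg C₁ ⟨hC₁, hC₁'⟩
    simpa using Real.rpow_le_rpow_of_exponent_ge hC₁ hC₁'.le (show 1 ≤ 1 + Φ C₁ by linarith)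
  have hsmall : ∀ᶠ n in atTop, 2 * M.contraction u i n < C₁ ^ (1 + Φ C₁) := by
    have := (M.tendsto_contraction u i).const_mul 2
    rw [mul_zero] at this
    exact this.eventually_lt_const hpow
  have key : ∀ᶠ n : ℕ in atTop,
      (Real.log C₂ + d * Real.log (C₁ / 2)) / n +
        (∑ k ∈ Finset.range n, Real.log (v k (i k))) / n ≤
      d * ((∑ k ∈ Finset.range n, Real.log (M.a (i k) (u k))) / n) := by
    filter_upwards [hsmall] with n hn
    have hcon := M.contraction_pos u i n
    have hr : 0 < 2 * M.contraction u i n := by positivity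
    have h1 := hd _ C₁ hr hn hpow' le_rfl _ (M.coding_mem_support hv)
    have hprod : 0 < ∏ k ∈ Finset.range n, v k (i k) := Finset.prod_pos fun k _ => hv k
    have h2 : ∏ k ∈ Finset.range n, v k (i k) ≤ (M.randomMeasure u v).real
        (Metric.ball (M.coding u i) (2 * M.contraction u i n)) := by
      rw [← M.randomMeasure_real_interval u]
      exact measureReal_mono (M.interval_subset_ball (by linarith))
    have h4 : Real.log C₂ + d * (Real.log (C₁ / 2) -
          ∑ k ∈ Finset.range n, Real.log (M.a (i k) (u k))) ≤
        - ∑ k ∈ Finset.range n, Real.log (v k (i k)) := by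
      rw [← log_contraction, ← Real.log_prod fun k _ => (hv k).ne',
        ← Real.log_div (by positivity) hcon.ne', ← Real.log_rpow (by positivity),
        ← Real.log_mul hC₂.ne' (by positivity), div_div, ← Real.log_inv, ← one_div]
      refine Real.log_le_log (by positivity) (h1.trans ?_)
      gcongr
      exact measureReal_le_one
    rw [← mul_div_assoc, ← add_div]
    gcongr
    linarith
  refine le_of_tendsto_of_tendsto ?_ (ha.const_mul d) key
  simpa using (tendsto_const_div_atTop_nhds_zero_nat _).add hp

end LocalDimension

end MoranFamily

/-! ### Averages along an independent identically distributed sequence -/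

theorem ae_tendsto_average {α : Type*} [MeasurableSpace α] (P : Measure α) [IsProbabilityMeasure P]
    {f : α → ℝ} (hf : Measurable f) (hint : Integrable f P) :
    ∀ᵐ x ∂(Measure.infinitePi fun _ : ℕ => P),
      Tendsto (fun n : ℕ => (∑ k ∈ Finset.range n, f (x k)) / n) atTop (𝓝 (∫ y, f y ∂P)) := by
  have hmp (n : ℕ) : MeasurePreserving (Function.eval n) (Measure.infinitePi fun _ : ℕ => P) P :=
    measurePreserving_eval_infinitePi (fun _ : ℕ => P) n
  have h := ProbabilityTheory.strong_law_ae_real (μ := Measure.infinitePi fun _ : ℕ => P)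
    (fun n x => f (x n)) ((hmp 0).integrable_comp_of_integrable hint)
    (fun m n hmn =>
      (ProbabilityTheory.iIndepFun_infinitePi (P := fun _ : ℕ => P) (X := fun _ => f)
        fun _ => hf).indepFun hmn)
    (fun n => by
      refine ⟨(hf.comp (measurable_pi_apply n)).aemeasurable,
        (hf.comp (measurable_pi_apply 0)).aemeasurable, ?_⟩
      have h1 := Measure.map_map (μ := Measure.infinitePi fun _ : ℕ => P) hf (hmp n).measurable
      have h2 := Measure.map_map (μ := Measure.infinitePi fun _ : ℕ => P) hf (hmp 0).measurable
      rw [(hmp n).map_eq] at h1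
      rw [(hmp 0).map_eq] at h2
      exact h1.symm.trans h2)
  have h0 : ∫ x, f (x 0) ∂(Measure.infinitePi fun _ : ℕ => P) = ∫ y, f y ∂P := by
    have h1 := integral_map (μ := Measure.infinitePi fun _ : ℕ => P)
      (hmp 0).measurable.aemeasurable (f := f) hf.aestronglyMeasurable
    rw [(hmp 0).map_eq] at h1
    exact h1.symm
  rwa [h0] at h

namespace MoranFamily

variable {K : ℕ} {𝒜 : Type*} [MeasurableSpace 𝒜] (M : MoranFamily K 𝒜)

/-! ### The Hausdorff dimension of the random Moran set -/

/-- The sum `∑ ℓ, a ℓ u ^ θ` of the scaling ratios to the power `θ`. -/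
def powerSum (θ : ℝ) (u : 𝒜) : ℝ := ∑ ℓ, M.a ℓ u ^ θ

theorem nonempty_fin (M : MoranFamily K 𝒜) : Nonempty (Fin K) := ⟨⟨0, by have := M.two_le; omega⟩⟩

theorem A_lt_one : M.A < 1 := by
  obtain ⟨j⟩ := M.nonempty_fin
  by_contra h
  have h0 := M.mul_A_le
  have h1 := M.B_lt_one
  have h2 : (2 : ℝ) ≤ K := by exact_mod_cast M.two_le
  nlinarith

theorem powerSum_pos (θ : ℝ) (u : 𝒜) : 0 < M.powerSum θ u :=
  have := M.nonempty_fin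
  Finset.sum_pos (fun j _ => Real.rpow_pos_of_pos (M.a_pos j u) θ) Finset.univ_nonempty

theorem measurable_powerSum (θ : ℝ) : Measurable (M.powerSum θ) :=
  Finset.measurable_sum _ fun j _ => (M.measurable_a j).pow_const θ

theorem integrable_log_powerSum (Q : Measure 𝒜) [IsProbabilityMeasure Q] {θ : ℝ} (hθ : 0 ≤ θ) :
    Integrable (fun u => Real.log (M.powerSum θ u)) Q := by
  refine Integrable.of_bound (M.measurable_powerSum θ).log.aestronglyMeasurable
    (max (Real.log K) (-Real.log (M.A ^ θ))) (ae_of_all _ fun u => ?_)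
  obtain ⟨j⟩ := M.nonempty_fin
  have hA := M.A_pos
  rw [Real.norm_eq_abs, abs_le]
  constructor
  · refine neg_le.1 (le_max_of_le_right (neg_le_neg (Real.log_le_log (by positivity) ?_)))
    refine le_trans ?_ (Finset.single_le_sum (f := fun j => M.a j u ^ θ)
      (fun j _ => Real.rpow_nonneg (M.a_pos j u).le θ) (Finset.mem_univ j))
    exact Real.rpow_le_rpow hA.le (M.A_le j u) hθ
  · refine le_max_of_le_left (Real.log_le_log (M.powerSum_pos θ u) ?_)
    calc M.powerSum θ u ≤ ∑ _j : Fin K, (1 : ℝ) := Finset.sum_le_sum fun j _ =>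
          Real.rpow_le_one (M.a_pos j u).le ((M.a_le j u).trans M.B_lt_one.le) hθ
      _ = K := by simp

/-- Increasing the exponent by `ε` multiplies each summand by at least `A ^ ε`. -/
theorem log_powerSum_add_le {θ ε : ℝ} (hε : 0 ≤ ε) (u : 𝒜) :
    Real.log (M.powerSum θ u) + ε * Real.log M.A ≤ Real.log (M.powerSum (θ + ε) u) := by
  have hA := M.A_pos
  rw [← Real.log_rpow hA, ← Real.log_mul (M.powerSum_pos θ u).ne' (by positivity)]
  refine Real.log_le_log (mul_pos (M.powerSum_pos θ u) (by positivity)) ?_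
  rw [powerSum, powerSum, Finset.sum_mul]
  refine Finset.sum_le_sum fun j _ => ?_
  rw [Real.rpow_add (M.a_pos j u)]
  have := M.a_pos j u
  gcongr
  exact M.A_le j u

theorem integral_log_powerSum_add_le (Q : Measure 𝒜) [IsProbabilityMeasure Q] {θ ε : ℝ}
    (hθ : 0 ≤ θ) (hε : 0 ≤ ε) :
    ∫ u, Real.log (M.powerSum θ u) ∂Q + ε * Real.log M.A ≤
      ∫ u, Real.log (M.powerSum (θ + ε) u) ∂Q := by
  have h := integral_mono ((M.integrable_log_powerSum Q hθ).add (integrable_const _))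
    (M.integrable_log_powerSum Q (add_nonneg hθ hε)) (M.log_powerSum_add_le (θ := θ) hε)
  rwa [integral_add' (M.integrable_log_powerSum Q hθ) (integrable_const _), integral_const,
    probReal_univ, one_smul] at h

theorem prod_powerSum_eq_exp (θ : ℝ) (u : ℕ → 𝒜) (n : ℕ) :
    ∏ k ∈ Finset.range n, M.powerSum θ (u k) =
      Real.exp (n * ((∑ k ∈ Finset.range n, Real.log (M.powerSum θ (u k))) / n)) := by
  rcases Nat.eq_zero_or_pos n with rfl | hn
  · simp
  · rw [mul_div_cancel₀ _ (by positivity), Real.exp_sum]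
    exact Finset.prod_congr rfl fun k _ => (Real.exp_log (M.powerSum_pos _ _)).symm

/-- The Moran intervals of step `n` cover the Moran set, and their lengths to the power `θ` add up
to the product of the power sums. -/
theorem dimH_moranSet_le {u : ℕ → 𝒜} {θ : ℝ} (hθ : 0 ≤ θ)
    (h : Tendsto (fun n : ℕ => ∏ k ∈ Finset.range n, M.powerSum θ (u k)) atTop (𝓝 0)) :
    dimH (M.moranSet u) ≤ ENNReal.ofReal θ := by
  refine dimH_le_of_hausdorffMeasure_ne_top (d := θ.toNNReal) ?_
  rw [Real.coe_toNNReal θ hθ]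
  obtain ⟨j₀⟩ := M.nonempty_fin
  let extend (n : ℕ) (w : Fin n → Fin K) (k : ℕ) : Fin K := if h : k < n then w ⟨k, h⟩ else j₀
  have hdiam (n : ℕ) (w : Fin n → Fin K) : Metric.ediam (M.interval u (extend n w) n) ≤
      ENNReal.ofReal (M.contraction u (extend n w) n) :=
    Metric.ediam_le fun x hx y hy => by
      rw [edist_dist]
      exact ENNReal.ofReal_le_ofReal (M.dist_le_of_mem_interval hx hy)
  have hsum (n : ℕ) : ∑ w : Fin n → Fin K, Metric.ediam (M.interval u (extend n w) n) ^ θ ≤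
      ENNReal.ofReal (∏ k ∈ Finset.range n, M.powerSum θ (u k)) := by
    calc _ ≤ ∑ w : Fin n → Fin K, ENNReal.ofReal (∏ k : Fin n, M.a (w k) (u k) ^ θ) := by
          refine Finset.sum_le_sum fun w _ => ?_
          refine (ENNReal.rpow_le_rpow (hdiam n w) hθ).trans ?_
          rw [ENNReal.ofReal_rpow_of_nonneg (M.contraction_pos _ _ _).le hθ, contraction,
            Finset.prod_range, ← Real.finsetProd_rpow _ _ fun k _ => (M.a_pos _ _).le]
          simp [extend]
      _ = _ := by
          rw [← ENNReal.ofReal_sum_of_nonneg fun w _ => Finset.prod_nonneg fun k _ =>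
            Real.rpow_nonneg (M.a_pos _ _).le θ, Finset.prod_range]
          simp only [powerSum]
          rw [Fintype.prod_sum]
  have hlim := tendsto_of_tendsto_of_tendsto_of_le_of_le tendsto_const_nhds
    (by simpa using ENNReal.tendsto_ofReal h) (fun n => zero_le) hsum
  have hB : Tendsto (fun n => ENNReal.ofReal (M.B ^ n)) atTop (𝓝 0) := by
    simpa using ENNReal.tendsto_ofReal
      (tendsto_pow_atTop_nhds_zero_of_lt_one M.B_pos.le M.B_lt_one)
  have hmeas := Measure.hausdorffMeasure_le_liminf_sum (ι := fun n : ℕ => Fin n → Fin K) θ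
    (M.moranSet u) (l := atTop) (fun n => ENNReal.ofReal (M.B ^ n))
    hB
    (fun n w => M.interval u (extend n w) n)
    (Eventually.of_forall fun n w =>
      (hdiam n w).trans (ENNReal.ofReal_le_ofReal (M.contraction_le _ _ _)))
    (Eventually.of_forall fun n x hx => by
      obtain ⟨i, hi⟩ := Set.mem_iUnion.1 (Set.mem_iInter.1 hx n)
      refine Set.mem_iUnion.2 ⟨fun k => i k, ?_⟩
      rwa [M.interval_congr u (j := i) fun k hk => by simp [extend, hk]])
  rw [hlim.liminf_eq] at hmeas
  exact (hmeas.trans_lt ENNReal.zero_lt_top).ne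

/-- The vector of natural weights `a i u ^ θ / ∑ ℓ, a ℓ u ^ θ`. -/
def naturalWeights (θ : ℝ) (u : 𝒜) : Weights K :=
  ⟨fun i => M.naturalWeight θ i u,
    fun i => div_nonneg (Real.rpow_nonneg (M.a_pos i u).le θ) (M.powerSum_pos θ u).le, by
    simp only [naturalWeight]
    rw [← Finset.sum_div]
    exact div_self (M.powerSum_pos θ u).ne'⟩

theorem prod_naturalWeights (θ : ℝ) (u : ℕ → 𝒜) (i : ℕ → Fin K) (n : ℕ) :
    ∏ k ∈ Finset.range n, M.naturalWeights θ (u k) (i k) =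
      M.contraction u i n ^ θ / ∏ k ∈ Finset.range n, M.powerSum θ (u k) := by
  rw [contraction, ← Real.finsetProd_rpow _ _ fun k _ => (M.a_pos _ _).le,
    ← Finset.prod_div_distrib]
  rfl

/-- The mass distribution principle, applied to the random measure with natural weights: a set of
diameter between `τ` times the lengths of the step `n + 1` and the step `n` intervals around one
of its points has at most the mass of the latter. -/
theorem le_dimH_moranSet {u : ℕ → 𝒜} {θ : ℝ} (hθ : 0 < θ)
    (h : Tendsto (fun n : ℕ => ∏ k ∈ Finset.range n, M.powerSum θ (u k)) atTop atTop) :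
    ENNReal.ofReal θ ≤ dimH (M.moranSet u) := by
  have hA := M.A_pos
  have hτ := M.τ_pos
  set μ := M.randomMeasure u fun k => M.naturalWeights θ (u k) with hμ
  obtain ⟨N, hN⟩ := eventually_atTop.1 (h.eventually_ge_atTop (((M.τ * M.A) ^ θ)⁻¹))
  have hApos : 0 < M.A ^ N := by positivity
  have hmass {s : Set I} (hs : IsClosed s) {i : ℕ → Fin K} (hi : M.coding u i ∈ s) {n : ℕ}
      (hn : N ≤ n) (hd : Metric.diam s < M.τ * M.contraction u i n) :
      μ s ≤ ENNReal.ofReal ((M.contraction u i n * (M.τ * M.A)) ^ θ) := by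
    have hcon := M.contraction_pos u i n
    refine (M.randomMeasure_le_interval u _ i n hs.measurableSet fun y hy =>
      (Metric.dist_le_diam_of_mem (Metric.isBounded_of_compactSpace (s := s)) hi hy).trans_lt hd).trans ?_
    rw [← ofReal_measureReal, randomMeasure_real_interval, prod_naturalWeights,
      Real.mul_rpow hcon.le (by positivity), div_eq_mul_inv]
    gcongr
    exact inv_le_of_inv_le₀ (by positivity) (hN n hn)
  have hle : μ ≤ Measure.hausdorffMeasure θ := by
    refine Measure.le_hausdorffMeasure θ μ (ENNReal.ofReal (M.τ * M.A ^ N / 2))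
      (ENNReal.ofReal_pos.2 (by positivity)) fun s hs => ?_
    refine (measure_mono subset_closure).trans ?_
    rw [← Metric.ediam_closure] at hs ⊢
    have hcl : IsClosed (closure s) := isClosed_closure
    generalize closure s = s at hs hcl
    by_cases hne : ∃ i, M.coding u i ∈ s
    swap
    · rw [hμ, randomMeasure, Measure.map_apply (M.measurable_coding u) hcl.measurableSet,
        show M.coding u ⁻¹' s = ∅ from Set.eq_empty_of_forall_notMem fun i hi => hne ⟨i, hi⟩,
        measure_empty]
      exact zero_le
    obtain ⟨i, hi⟩ := hne
    have hfin : Metric.ediam s ≠ ∞ := (hs.trans_lt ENNReal.ofReal_lt_top).ne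
    have hdiam : Metric.ediam s = ENNReal.ofReal (Metric.diam s) :=
      (ENNReal.ofReal_toReal hfin).symm
    rw [hdiam, ENNReal.ofReal_le_ofReal_iff (by positivity)] at hs
    rw [hdiam, ENNReal.ofReal_rpow_of_nonneg Metric.diam_nonneg hθ.le]
    have hcN : M.A ^ N ≤ M.contraction u i N := by
      simpa [contraction] using Finset.prod_le_prod (s := Finset.range N)
        (fun _ _ => hA.le) fun k _ => M.A_le (i k) (u k)
    rcases (Metric.diam_nonneg (s := s)).eq_or_lt with h0 | hpos
    · have hlim : Tendsto (fun n => ENNReal.ofReal ((M.contraction u i n * (M.τ * M.A)) ^ θ)) atTop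
          (𝓝 0) := by
        have h1 := ((M.tendsto_contraction u i).mul_const (M.τ * M.A)).rpow_const
          (p := θ) (Or.inr hθ.le)
        rw [zero_mul, Real.zero_rpow hθ.ne'] at h1
        simpa using ENNReal.tendsto_ofReal h1
      refine (ge_of_tendsto hlim ?_).trans zero_le
      filter_upwards [eventually_ge_atTop N] with n hn
      refine hmass hcl hi hn ?_
      rw [← h0]
      exact mul_pos hτ (M.contraction_pos u i n)
    · have hex : ∃ n, M.τ * M.contraction u i n ≤ Metric.diam s := by
        have h1 := (M.tendsto_contraction u i).const_mul M.τ
        rw [mul_zero] at h1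
        exact (h1.eventually_le_const hpos).exists
      classical
      have hfind : N < Nat.find hex := by
        by_contra! hlt
        have h1 := Nat.find_spec hex
        have h2 := M.contraction_antitone u i hlt
        nlinarith
      obtain ⟨n, hn⟩ := Nat.exists_eq_add_of_lt hfind
      have h1 := Nat.find_spec hex
      have h2 := Nat.find_min hex (m := N + n) (by omega)
      rw [hn, contraction_succ] at h1
      refine (hmass hcl hi (Nat.le_add_right N n) (not_le.1 h2)).trans ?_
      have hcon := M.contraction_pos u i (N + n)
      refine ENNReal.ofReal_le_ofReal (Real.rpow_le_rpow (by positivity) ?_ hθ.le)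
      have h3 := M.A_le (i (N + n)) (u (N + n))
      calc M.contraction u i (N + n) * (M.τ * M.A)
          = M.τ * (M.contraction u i (N + n) * M.A) := by ring
        _ ≤ _ := (by gcongr : _ ≤ M.τ * (M.contraction u i (N + n) *
            M.a (i (N + n)) (u (N + n)))).trans h1
  refine le_dimH_of_hausdorffMeasure_ne_zero (d := θ.toNNReal) ?_
  rw [Real.coe_toNNReal θ hθ.le]
  have hone : 1 ≤ μ (M.moranSet u) := by
    refine le_trans ?_ (Measure.le_map_apply (M.measurable_coding u).aemeasurable _)
    rw [Set.eq_univ_of_forall (s := M.coding u ⁻¹' M.moranSet u) (M.coding_mem_moranSet u),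
      measure_univ]
  exact (zero_lt_one.trans_le (hone.trans (hle _))).ne'

theorem ae_dimH_moranSet_le (Q : Measure 𝒜) [IsProbabilityMeasure Q] {θ : ℝ} (hθ : 0 ≤ θ)
    (h : ∫ u, Real.log (M.powerSum θ u) ∂Q < 0) :
    ∀ᵐ u ∂(Measure.infinitePi fun _ : ℕ => Q), dimH (M.moranSet u) ≤ ENNReal.ofReal θ := by
  filter_upwards [ae_tendsto_average Q (M.measurable_powerSum θ).log
    (M.integrable_log_powerSum Q hθ)] with u hu
  refine M.dimH_moranSet_le hθ ?_
  simp only [prod_powerSum_eq_exp]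
  exact Real.tendsto_exp_atBot.comp (tendsto_natCast_atTop_atTop.atTop_mul_neg h hu)

theorem ae_le_dimH_moranSet (Q : Measure 𝒜) [IsProbabilityMeasure Q] {θ : ℝ} (hθ : 0 < θ)
    (h : 0 < ∫ u, Real.log (M.powerSum θ u) ∂Q) :
    ∀ᵐ u ∂(Measure.infinitePi fun _ : ℕ => Q), ENNReal.ofReal θ ≤ dimH (M.moranSet u) := by
  filter_upwards [ae_tendsto_average Q (M.measurable_powerSum θ).log
    (M.integrable_log_powerSum Q hθ.le)] with u hu
  refine M.le_dimH_moranSet hθ ?_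
  simp only [prod_powerSum_eq_exp]
  exact Real.tendsto_exp_atTop.comp (tendsto_natCast_atTop_atTop.atTop_mul_pos h hu)

/-- The almost sure Hausdorff dimension of the random Moran set solves the expected logarithmic
Moran equation. -/
theorem integral_log_powerSum_eq_zero (Q : Measure 𝒜) [IsProbabilityMeasure Q] {D : ℝ}
    (hD₀ : 0 ≤ D)
    (hD : ∀ᵐ u ∂(Measure.infinitePi fun _ : ℕ => Q), dimH (M.moranSet u) = ENNReal.ofReal D) :
    ∫ u, Real.log (M.powerSum D u) ∂Q = 0 := by
  have hA : Real.log M.A < 0 := Real.log_neg M.A_pos M.A_lt_one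
  set φ := ∫ u, Real.log (M.powerSum D u) ∂Q with hφ
  rcases lt_trichotomy φ 0 with hneg | h | hpos
  · exfalso
    have hK : 0 < Real.log K := Real.log_pos (by exact_mod_cast M.two_le)
    have h0 : ∫ u, Real.log (M.powerSum 0 u) ∂Q = Real.log K := by simp [powerSum]
    have hDpos : 0 < D := by
      refine hD₀.lt_of_ne fun h => ?_
      rw [hφ, ← h, h0] at hneg
      exact hK.not_gt hneg
    -- lowering the exponent by `ε` changes the expectation by at most `φ / 2`
    obtain ⟨ε, hε, hεD, hεφ⟩ : ∃ ε > 0, ε ≤ D ∧ φ - ε * Real.log M.A < 0 := by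
      refine ⟨min D (φ / (2 * Real.log M.A)), lt_min hDpos (div_pos_of_neg_of_neg hneg (by linarith)),
        min_le_left _ _, ?_⟩
      have h1 : φ / (2 * Real.log M.A) * Real.log M.A = φ / 2 := by
        have := hA.ne
        field_simp
      have h2 := min_le_right D (φ / (2 * Real.log M.A))
      nlinarith
    have hle := M.integral_log_powerSum_add_le Q (sub_nonneg.2 hεD) hε.le
    rw [sub_add_cancel] at hle
    obtain ⟨u, hu1, hu2⟩ :=
      (hD.and (M.ae_dimH_moranSet_le Q (sub_nonneg.2 hεD) (by linarith))).exists
    rw [hu1, ENNReal.ofReal_le_ofReal_iff (by linarith)] at hu2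
    linarith
  · exact h
  · exfalso
    obtain ⟨ε, hε, hεφ⟩ : ∃ ε > 0, 0 < φ + ε * Real.log M.A := by
      refine ⟨-φ / (2 * Real.log M.A), div_pos_of_neg_of_neg (by linarith) (by linarith), ?_⟩
      have h1 : -φ / (2 * Real.log M.A) * Real.log M.A = -φ / 2 := by
        have := hA.ne
        field_simp
      linarith
    have hle := M.integral_log_powerSum_add_le Q hD₀ hε.le
    obtain ⟨u, hu1, hu2⟩ :=
      (hD.and (M.ae_le_dimH_moranSet Q (θ := D + ε) (by linarith) (by linarith))).exists
    rw [hu1, ENNReal.ofReal_le_ofReal_iff hD₀] at hu2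
    linarith

end MoranFamily

/-! ### Random digits -/

theorem measurable_min'_filter {K : ℕ} {α : Type*} [MeasurableSpace α] {p : α → Fin K → Prop}
    [∀ l, DecidablePred (p l)] (hp : ∀ k, MeasurableSet {l | p l k})
    (hne : ∀ l, (Finset.univ.filter (p l)).Nonempty) :
    Measurable fun l => (Finset.univ.filter (p l)).min' (hne l) := by
  refine measurable_to_countable' fun k => ?_
  have h : (fun l => (Finset.univ.filter (p l)).min' (hne l)) ⁻¹' {k} =
      {l | p l k} ∩ ⋂ j, {l | p l j → k ≤ j} := by
    ext l
    simp only [Set.mem_preimage, Set.mem_singleton_iff, Set.mem_inter_iff, Set.mem_ofPred_eq,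
      Set.mem_iInter]
    constructor
    · rintro rfl
      exact ⟨(Finset.mem_filter.1 (Finset.min'_mem _ (hne l))).2,
        fun j hj => Finset.min'_le _ _ (by simpa using hj)⟩
    · rintro ⟨h1, h2⟩
      exact le_antisymm (Finset.min'_le _ _ (by simpa using h1))
        (Finset.le_min' _ _ _ fun j hj => h2 j (Finset.mem_filter.1 hj).2)
  rw [h]
  exact (hp k).inter (MeasurableSet.iInter fun j => (hp j).imp (MeasurableSet.const _))

theorem measurable_selected {K : ℕ} {α : Type*} [MeasurableSpace α] {f : Fin K → α → ℝ}
    (hf : ∀ j, Measurable (f j)) {e : α → Fin K} (he : Measurable e) :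
    Measurable fun l => f (e l) l := by
  have h : Measurable fun q : α × Fin K => f q.2 q.1 := measurable_from_prod_countable_left hf
  exact h.comp (measurable_id.prodMk he)

theorem integrable_selected {K : ℕ} {α : Type*} [MeasurableSpace α] {P : Measure α}
    {f : Fin K → α → ℝ} (hf : ∀ j, Measurable (f j)) (hint : ∀ j, Integrable (f j) P)
    {e : α → Fin K} (he : Measurable e) : Integrable (fun l => f (e l) l) P := by
  refine Integrable.mono' (integrable_finsetSum Finset.univ fun j _ => (hint j).abs)
    (measurable_selected hf he).aestronglyMeasurable (ae_of_all _ fun l => ?_)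
  exact Finset.single_le_sum (f := fun j => |f j l|) (fun j _ => abs_nonneg _)
    (Finset.mem_univ (e l))

theorem measurable_weight {K : ℕ} (i : Fin K) : Measurable fun v : Weights K => v i :=
  (measurable_pi_apply i).comp measurable_subtype_coe

theorem IsAdmissible.ae_pos {K : ℕ} {ρ : Measure (Weights K)} (h : IsAdmissible ρ) :
    ∀ᵐ v ∂ρ, ∀ i, 0 < v i := by
  obtain ⟨t, ht, h⟩ := h
  refine ae_all_iff.2 fun i => ?_
  filter_upwards [ae_lt_top ((measurable_weight i).ennreal_ofReal.pow_const _) (h i).ne] with v hv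
  by_contra hle
  rw [ENNReal.ofReal_of_nonpos (not_lt.1 hle), ENNReal.zero_rpow_of_neg (by linarith)] at hv
  exact lt_irrefl _ hv

theorem weight_le_one {K : ℕ} (v : Weights K) (i : Fin K) : v i ≤ 1 :=
  (Finset.single_le_sum (f := fun j => v j) (fun j _ => v.2.1 j) (Finset.mem_univ i)).trans
    v.2.2.le

/-- The bound `-log x ≤ x ^ (-t) / t` turns the moment condition into integrability. -/
theorem IsAdmissible.integrable_log {K : ℕ} {ρ : Measure (Weights K)} (h : IsAdmissible ρ)
    (i : Fin K) : Integrable (fun v : Weights K => Real.log (v i)) ρ := by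
  have hpos := h.ae_pos
  obtain ⟨t, ht, h⟩ := h
  have hint : Integrable (fun v : Weights K => v i ^ (-t)) ρ := by
    refine (lintegral_ofReal_ne_top_iff_integrable
      ((measurable_weight i).pow_const _).aestronglyMeasurable
      (ae_of_all _ fun v => Real.rpow_nonneg (v.2.1 i) _)).1 (ne_of_eq_of_ne ?_ (h i).ne)
    refine lintegral_congr_ae ?_
    filter_upwards [hpos] with v hv
    exact (ENNReal.ofReal_rpow_of_pos (hv i)).symm
  refine Integrable.mono' (hint.div_const t) (measurable_weight i).log.aestronglyMeasurable ?_
  filter_upwards [hpos] with v hv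
  rw [Real.norm_eq_abs, abs_of_nonpos (Real.log_nonpos (hv i).le (weight_le_one v i)),
    ← Real.log_inv, Real.rpow_neg (hv i).le, ← Real.inv_rpow (hv i).le]
  exact Real.log_le_rpow_div (inv_nonneg.2 (hv i).le) ht

/-! ### Comparison of two weight vectors -/

/-- If the quotient `y j / x j` of two probability vectors is maximal at `j = m`, then
`y m / x m` is at least the quotient of the masses of any set of indices, here of the complement
of `{i}` and of the whole index set. -/
theorem cross_mul_le {K : ℕ} {x y : Fin K → ℝ} (hx : ∑ j, x j = 1) (hy : ∑ j, y j = 1) {m : Fin K}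
    (h : ∀ j, y j * x m ≤ y m * x j) (i : Fin K) :
    (1 - y i) * x m ≤ y m * (1 - x i) ∧ x m ≤ y m := by
  have h1 := Finset.sum_le_sum fun j (_ : j ∈ Finset.univ.erase i) => h j
  rw [← Finset.sum_mul, ← Finset.mul_sum, Finset.sum_erase_eq_sub (Finset.mem_univ i),
    Finset.sum_erase_eq_sub (Finset.mem_univ i), hx, hy] at h1
  exact ⟨h1, by linarith [h i]⟩

theorem log_div_le_log_sub_log {s t x y : ℝ} (hs : 0 < s) (ht : 0 < t) (hx : 0 < x)
    (h : t * x ≤ y * s) : Real.log (t / s) ≤ Real.log y - Real.log x := by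
  have hy : 0 < y := pos_of_mul_pos_left ((mul_pos ht hx).trans_le h) hs.le
  rw [← Real.log_div hy.ne' hx.ne']
  exact Real.log_le_log (div_pos ht hs) ((div_le_div_iff₀ hs hx).2 h)

namespace MoranFamily

variable {K : ℕ} {𝒜 : Type*} [MeasurableSpace 𝒜] (M : MoranFamily K 𝒜)

theorem measurable_ratio (θ : ℝ) (j : Fin K) : Measurable fun l => M.ratio θ l j :=
  (((M.measurable_a j).comp measurable_fst).pow_const θ).div
    ((measurable_weight j).comp measurable_snd)

theorem measurable_m (θ : ℝ) : Measurable (M.m θ) :=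
  measurable_min'_filter (p := fun l k => ∀ j, M.ratio θ l j ≤ M.ratio θ l k)
    (fun k => by
      simp only [Set.ofPred_forall]
      exact MeasurableSet.iInter fun j =>
        measurableSet_le (M.measurable_ratio θ j) (M.measurable_ratio θ k))
    (M.exists_max θ)

theorem measurable_m' (θ : ℝ) : Measurable (M.m' θ) :=
  measurable_min'_filter (p := fun l k => ∀ j, M.ratio θ l k ≤ M.ratio θ l j)
    (fun k => by
      simp only [Set.ofPred_forall]
      exact MeasurableSet.iInter fun j =>
        measurableSet_le (M.measurable_ratio θ k) (M.measurable_ratio θ j))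
    (M.exists_min θ)

theorem ratio_le_ratio_m (θ : ℝ) (l : 𝒜 × Weights K) (j : Fin K) :
    M.ratio θ l j ≤ M.ratio θ l (M.m θ l) :=
  (Finset.mem_filter.1 (Finset.min'_mem _ (M.exists_max θ l))).2 j

theorem ratio_m'_le_ratio (θ : ℝ) (l : 𝒜 × Weights K) (j : Fin K) :
    M.ratio θ l (M.m' θ l) ≤ M.ratio θ l j :=
  (Finset.mem_filter.1 (Finset.min'_mem _ (M.exists_min θ l))).2 j

theorem naturalWeight_pos (θ : ℝ) (j : Fin K) (u : 𝒜) : 0 < M.naturalWeight θ j u :=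
  div_pos (Real.rpow_pos_of_pos (M.a_pos j u) θ) (M.powerSum_pos θ u)

theorem sum_naturalWeight (θ : ℝ) (u : 𝒜) : ∑ j, M.naturalWeight θ j u = 1 :=
  (M.naturalWeights θ u).2.2

theorem naturalWeight_lt_one (θ : ℝ) (j : Fin K) (u : 𝒜) : M.naturalWeight θ j u < 1 := by
  have : Nontrivial (Fin K) := Fin.nontrivial_iff_two_le.2 M.two_le
  obtain ⟨k, hk⟩ := exists_ne j
  rw [← M.sum_naturalWeight θ u]
  exact Finset.single_lt_sum (f := fun j => M.naturalWeight θ j u) hk (Finset.mem_univ j) (Finset.mem_univ k)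
    (M.naturalWeight_pos θ k u) fun _ _ _ => (M.naturalWeight_pos θ _ u).le

theorem log_naturalWeight (θ : ℝ) (j : Fin K) (u : 𝒜) :
    Real.log (M.naturalWeight θ j u) =
      θ * Real.log (M.a j u) - Real.log (M.powerSum θ u) := by
  rw [← Real.log_rpow (M.a_pos j u), ← Real.log_div
    (Real.rpow_pos_of_pos (M.a_pos j u) θ).ne' (M.powerSum_pos θ u).ne']
  rfl

theorem naturalWeight_mul_le_of_ratio_le {θ : ℝ} {l : 𝒜 × Weights K} {j k : Fin K}
    (hj : 0 < l.2 j) (hk : 0 < l.2 k) (h : M.ratio θ l j ≤ M.ratio θ l k) :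
    M.naturalWeight θ j l.1 * l.2 k ≤ M.naturalWeight θ k l.1 * l.2 j := by
  rw [ratio, ratio, div_le_div_iff₀ hj hk] at h
  rw [naturalWeight, naturalWeight, div_mul_eq_mul_div, div_mul_eq_mul_div]
  exact div_le_div_of_nonneg_right h (M.powerSum_pos θ l.1).le

section Digit

variable (Q : Measure 𝒜) [IsProbabilityMeasure Q] {ρ : Measure (Weights K)}
  [IsProbabilityMeasure ρ] {e : 𝒜 × Weights K → Fin K}

theorem measurable_log_a (j : Fin K) : Measurable fun l : 𝒜 × Weights K => Real.log (M.a j l.1) :=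
  ((M.measurable_a j).comp measurable_fst).log

theorem measurable_log_weight (j : Fin K) :
    Measurable fun l : 𝒜 × Weights K => Real.log (l.2 j) :=
  ((measurable_weight j).comp measurable_snd).log

theorem integrable_log_a (he : Measurable e) :
    Integrable (fun l => Real.log (M.a (e l) l.1)) (Q.prod ρ) := by
  refine Integrable.of_bound (measurable_selected M.measurable_log_a he).aestronglyMeasurable
    (-Real.log M.A) (ae_of_all _ fun l => ?_)
  rw [Real.norm_eq_abs, abs_of_nonpos (Real.log_nonpos (M.a_pos _ _).le
    ((M.a_le _ _).trans M.B_lt_one.le))]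
  exact neg_le_neg (Real.log_le_log M.A_pos (M.A_le _ _))

theorem log_A_le_integral_log_a (he : Measurable e) :
    Real.log M.A ≤ ∫ l, Real.log (M.a (e l) l.1) ∂(Q.prod ρ) := by
  have h := integral_mono (integrable_const _) (M.integrable_log_a Q (ρ := ρ) he)
    fun l => Real.log_le_log M.A_pos (M.A_le (e l) l.1)
  simpa using h

theorem integral_log_a_neg (he : Measurable e) :
    ∫ l, Real.log (M.a (e l) l.1) ∂(Q.prod ρ) < 0 := by
  have h := integral_mono (M.integrable_log_a Q (ρ := ρ) he) (integrable_const _)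
    fun l => Real.log_le_log (M.a_pos (e l) l.1) (M.a_le (e l) l.1)
  refine lt_of_le_of_lt h ?_
  simpa using Real.log_neg M.B_pos M.B_lt_one

theorem integrable_log_weight (hρ : IsAdmissible ρ) (he : Measurable e) :
    Integrable (fun l : 𝒜 × Weights K => Real.log (l.2 (e l))) (Q.prod ρ) :=
  integrable_selected measurable_log_weight (fun j => (hρ.integrable_log j).comp_snd Q) he

/-- The digits `e (l n)` give an address at which the random measure has local dimension
`𝔼 (log p e) / 𝔼 (log a e)`. -/
theorem ae_phiDim_of_digit (hρ : IsAdmissible ρ) (he : Measurable e) :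
    ∀ᵐ l ∂(Measure.infinitePi fun _ : ℕ => Q.prod ρ), ∀ Φ : ℝ → ℝ, IsDimensionFunction Φ →
      (((∫ l, Real.log (l.2 (e l)) ∂(Q.prod ρ)) /
        ∫ l, Real.log (M.a (e l) l.1) ∂(Q.prod ρ) : ℝ) : EReal) ≤
          upperPhiDim Φ (M.randomMeasure (fun n => (l n).1) fun n => (l n).2) ∧
      lowerPhiDim Φ (M.randomMeasure (fun n => (l n).1) fun n => (l n).2) ≤
        (((∫ l, Real.log (l.2 (e l)) ∂(Q.prod ρ)) /
          ∫ l, Real.log (M.a (e l) l.1) ∂(Q.prod ρ) : ℝ) : EReal) := by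
  have hpos : ∀ᵐ l ∂(Measure.infinitePi fun _ : ℕ => Q.prod ρ), ∀ k i, 0 < (l k).2 i := by
    refine ae_all_iff.2 fun k => ?_
    exact ((Measure.quasiMeasurePreserving_snd (μ := Q) (ν := ρ)).comp
      (measurePreserving_eval_infinitePi (fun _ : ℕ => Q.prod ρ) k).quasiMeasurePreserving).ae
        hρ.ae_pos
  filter_upwards [hpos,
    ae_tendsto_average _ (measurable_selected measurable_log_weight he)
      (integrable_log_weight Q hρ he),
    ae_tendsto_average _ (measurable_selected M.measurable_log_a he)
      (M.integrable_log_a Q (ρ := ρ) he)] with l hv hp ha Φ hΦ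
  exact ⟨M.le_upperPhiDim (i := fun k => e (l k)) hΦ (fun k => hv k _)
      (M.integral_log_a_neg Q he) hp ha,
    M.lowerPhiDim_le (i := fun k => e (l k)) hΦ (fun k => hv k _)
      (M.integral_log_a_neg Q he) hp ha⟩

theorem integrable_log_naturalWeight {D : ℝ} (hD₀ : 0 ≤ D) (he : Measurable e) :
    Integrable (fun l => Real.log (M.naturalWeight D (e l) l.1)) (Q.prod ρ) := by
  simp only [log_naturalWeight]
  exact ((M.integrable_log_a Q he).const_mul D).sub ((M.integrable_log_powerSum Q hD₀).comp_fst ρ)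

theorem integral_log_naturalWeight {D : ℝ} (hD₀ : 0 ≤ D)
    (hD : ∫ u, Real.log (M.powerSum D u) ∂Q = 0) (he : Measurable e) :
    ∫ l, Real.log (M.naturalWeight D (e l) l.1) ∂(Q.prod ρ) =
      D * ∫ l, Real.log (M.a (e l) l.1) ∂(Q.prod ρ) := by
  simp only [log_naturalWeight]
  rw [integral_sub ((M.integrable_log_a Q he).const_mul D)
    ((M.integrable_log_powerSum Q hD₀).comp_fst ρ), integral_const_mul,
    integral_fun_fst (fun u => Real.log (M.powerSum D u)), hD, smul_zero, sub_zero]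

end Digit

/-! ### The gap between `D` and the local dimensions -/

/-- The environment and the weights are independent, so that whatever the distribution of the
weight `v i`, it lies on the wrong side of the natural weight with probability at least
`min (Q Υ₁) (Q Υ₂)`. -/
theorem min_le_measureReal_mismatch (Q : Measure 𝒜) [IsProbabilityMeasure Q]
    (ρ : Measure (Weights K)) [IsProbabilityMeasure ρ] (i : Fin K) (c : ℝ) {Υ₁ Υ₂ : Set 𝒜}
    (hΥ₁ : MeasurableSet Υ₁) :
    min (Q.real Υ₁) (Q.real Υ₂) ≤ (Q.prod ρ).real
      {l | (l.1 ∈ Υ₂ ∧ l.2 i ≤ c) ∨ (l.1 ∈ Υ₁ ∧ c < l.2 i)} := by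
  have hT : MeasurableSet {v : Weights K | v i ≤ c} :=
    measurableSet_le (measurable_weight i) measurable_const
  have hset : {l : 𝒜 × Weights K | (l.1 ∈ Υ₂ ∧ l.2 i ≤ c) ∨ (l.1 ∈ Υ₁ ∧ c < l.2 i)} =
      Υ₂ ×ˢ {v | v i ≤ c} ∪ Υ₁ ×ˢ {v | v i ≤ c}ᶜ := by
    ext l
    simp
  rw [hset, measureReal_union (Set.disjoint_left.2 fun l h1 h2 => h2.2 h1.2)
    (hΥ₁.prod hT.compl), measureReal_prod_prod, measureReal_prod_prod, probReal_compl_eq_one_sub hT]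
  have h0 : 0 ≤ ρ.real {v | v i ≤ c} := measureReal_nonneg
  have h1 : ρ.real {v | v i ≤ c} ≤ 1 := measureReal_le_one
  have h2 := min_le_left (Q.real Υ₁) (Q.real Υ₂)
  have h3 := min_le_right (Q.real Υ₁) (Q.real Υ₂)
  nlinarith

theorem mul_le_integral_of_le_on {α : Type*} [MeasurableSpace α] {P : Measure α}
    [IsFiniteMeasure P] {f : α → ℝ} (hint : Integrable f P) (h0 : 0 ≤ᵐ[P] f) {s : Set α}
    {β κ : ℝ} (hβ : 0 ≤ β) (hs : ∀ᵐ x ∂P, x ∈ s → β ≤ f x) (hκ : κ ≤ P.real s) :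
    β * κ ≤ ∫ x, f x ∂P := by
  refine le_trans ?_ (mul_meas_ge_le_integral_of_nonneg h0 hint β)
  gcongr
  exact hκ.trans (ENNReal.toReal_mono (measure_ne_top _ _) (measure_mono_ae hs))

/-- The gap `p / a - D` is at least `η / -L`; the factor `2` makes the bound strict. -/
theorem half_div_lt_div_sub {η a p D L : ℝ} (hη : 0 < η) (ha : a < 0) (hL : L ≤ a)
    (h : η ≤ D * a - p) : η / (2 * -L) < p / a - D := by
  have h1 : p / a - D = (D * a - p) / -a := by
    rw [div_neg, sub_div, mul_div_cancel_right₀ _ ha.ne]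
    ring
  rw [h1, div_lt_div_iff₀ (by linarith) (by linarith)]
  nlinarith

end MoranFamily

end

theorem mainTheorem4 {K : ℕ} {𝒜 : Type*} [MeasurableSpace 𝒜] (M : MoranFamily K 𝒜)
    (Q : Measure 𝒜) [IsProbabilityMeasure Q]
    -- `D` is the almost sure Hausdorff dimension of the random Moran set
    (D : ℝ) (hD₀ : 0 ≤ D)
    (hD : ∀ᵐ u ∂(Measure.infinitePi fun _ : ℕ => Q), dimH (M.moranSet u) = ENNReal.ofReal D)
    (i : Fin K) (Υ₁ Υ₂ : Set 𝒜) (hΥ₁ : MeasurableSet Υ₁) (hΥ₂ : MeasurableSet Υ₂)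
    (hQ₁ : 0 < Q Υ₁) (hQ₂ : 0 < Q Υ₂)
    (hsep : sSup (M.naturalWeight D i '' Υ₁) < sInf (M.naturalWeight D i '' Υ₂)) :
    ∃ δ₁ > 0, ∃ δ₂ > 0, ∀ (ρ : Measure (Weights K)) [IsProbabilityMeasure ρ], IsAdmissible ρ →
      M.G (Q.prod ρ) D - D > δ₁ ∧ D - M.G' (Q.prod ρ) D > δ₂ ∧
      ∀ᵐ l ∂(Measure.infinitePi fun _ : ℕ => Q.prod ρ),
        ∀ Φ : ℝ → ℝ, IsDimensionFunction Φ → IsLargeDimensionFunction Φ →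
          upperPhiDim Φ (M.randomMeasure (fun n => (l n).1) fun n => (l n).2) >
            ((D + δ₁ : ℝ) : EReal) ∧
          lowerPhiDim Φ (M.randomMeasure (fun n => (l n).1) fun n => (l n).2) <
            ((D - δ₂ : ℝ) : EReal) := by
  have hD0 := M.integral_log_powerSum_eq_zero Q hD₀ hD
  set c₁ := sSup (M.naturalWeight D i '' Υ₁)
  set c₂ := sInf (M.naturalWeight D i '' Υ₂)
  have hle₁ : ∀ u ∈ Υ₁, M.naturalWeight D i u ≤ c₁ := fun u hu =>
    le_csSup ⟨1, by rintro _ ⟨w, -, rfl⟩; exact (M.naturalWeight_lt_one D i w).le⟩ ⟨u, hu, rfl⟩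
  have hle₂ : ∀ u ∈ Υ₂, c₂ ≤ M.naturalWeight D i u := fun u hu =>
    csInf_le ⟨0, by rintro _ ⟨w, -, rfl⟩; exact (M.naturalWeight_pos D i w).le⟩ ⟨u, hu, rfl⟩
  have hc₁pos : 0 < c₁ := by
    obtain ⟨u, hu⟩ := nonempty_of_measure_ne_zero hQ₁.ne'
    exact (M.naturalWeight_pos D i u).trans_le (hle₁ u hu)
  have hc₂lt : c₂ < 1 := by
    obtain ⟨u, hu⟩ := nonempty_of_measure_ne_zero hQ₂.ne'
    exact (hle₂ u hu).trans_lt (M.naturalWeight_lt_one D i u)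
  -- a weight `v i` either is at most `c`, hence too small on `Υ₂`, or exceeds `c`, hence is too
  -- large on `Υ₁`
  obtain ⟨c, hc₁c, hcc₂⟩ := exists_between hsep
  have hκ : 0 < min (Q.real Υ₁) (Q.real Υ₂) :=
    lt_min (ENNReal.toReal_pos hQ₁.ne' (measure_ne_top _ _))
      (ENNReal.toReal_pos hQ₂.ne' (measure_ne_top _ _))
  set κ := min (Q.real Υ₁) (Q.real Υ₂)
  have hc : 0 < c := hc₁pos.trans hc₁c
  have hlog {s t : ℝ} (hs : 0 < s) (hst : s < t) : 0 < Real.log (t / s) :=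
    Real.log_pos ((one_lt_div hs).2 hst)
  set β := min (Real.log (c₂ / c)) (Real.log ((1 - c₁) / (1 - c)))
  set β' := min (Real.log (c / c₁)) (Real.log ((1 - c) / (1 - c₂)))
  have hβ : 0 < β := lt_min (hlog hc hcc₂) (hlog (by linarith) (by linarith))
  have hβ' : 0 < β' := lt_min (hlog hc₁pos hc₁c) (hlog (by linarith) (by linarith))
  have hA := Real.log_neg M.A_pos M.A_lt_one
  -- half of the lower bounds `β * κ / |log A|` and `β' * κ / |log A|` for the two gaps
  refine ⟨β * κ / (2 * -Real.log M.A), div_pos (by positivity) (by linarith),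
    β' * κ / (2 * -Real.log M.A), div_pos (by positivity) (by linarith), fun ρ _ hρ => ?_⟩
  have hpos : ∀ᵐ l ∂(Q.prod ρ), ∀ j, 0 < l.2 j :=
    (Measure.quasiMeasurePreserving_snd (μ := Q) (ν := ρ)).ae hρ.ae_pos
  have hmis := MoranFamily.min_le_measureReal_mismatch Q ρ i c (Υ₂ := Υ₂) hΥ₁
  have hG : β * κ / (2 * -Real.log M.A) < M.G (Q.prod ρ) D - D := by
    have he := M.measurable_m D
    refine MoranFamily.half_div_lt_div_sub (by positivity) (M.integral_log_a_neg Q he)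
      (M.log_A_le_integral_log_a Q he) ?_
    rw [← M.integral_log_naturalWeight Q hD₀ hD0 he, ← integral_sub
      (M.integrable_log_naturalWeight Q hD₀ he) (MoranFamily.integrable_log_weight Q hρ he)]
    have hcross : ∀ᵐ l ∂(Q.prod ρ), ∀ j, M.naturalWeight D j l.1 * l.2 (M.m D l) ≤
        M.naturalWeight D (M.m D l) l.1 * l.2 j := by
      filter_upwards [hpos] with l hl j
      exact M.naturalWeight_mul_le_of_ratio_le (hl _) (hl _) (M.ratio_le_ratio_m D l j)
    refine MoranFamily.mul_le_integral_of_le_on ((M.integrable_log_naturalWeight Q hD₀ he).sub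
      (MoranFamily.integrable_log_weight Q hρ he)) ?_ hβ.le ?_ hmis
    · filter_upwards [hpos, hcross] with l hl hcr
      exact sub_nonneg.2 (Real.log_le_log (hl _)
        (cross_mul_le l.2.2.2 (M.sum_naturalWeight D l.1) hcr i).2)
    · filter_upwards [hpos, hcross] with l hl hcr
      have hq := M.naturalWeight_pos D (M.m D l) l.1
      have hm := hl (M.m D l)
      rintro (⟨hu, hv⟩ | ⟨hu, hv⟩)
      · refine (min_le_left _ _).trans (log_div_le_log_sub_log hc (by linarith) hm ?_)
        have h1 := hcr i
        have h2 := hle₂ _ hu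
        nlinarith
      · refine (min_le_right _ _).trans
          (log_div_le_log_sub_log (by linarith) (by linarith) hm ?_)
        have h1 : (1 - M.naturalWeight D i l.1) * l.2 (M.m D l) ≤
            M.naturalWeight D (M.m D l) l.1 * (1 - l.2 i) :=
          (cross_mul_le l.2.2.2 (M.sum_naturalWeight D l.1) hcr i).1
        have h2 := hle₁ _ hu
        have h3 : M.naturalWeight D (M.m D l) l.1 * (1 - l.2 i) ≤
          M.naturalWeight D (M.m D l) l.1 * (1 - c) := by gcongr
        refine le_trans ?_ (h1.trans h3)
        gcongr
  have hG' : β' * κ / (2 * -Real.log M.A) < D - M.G' (Q.prod ρ) D := by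
    have he := M.measurable_m' D
    have hneg := M.integral_log_a_neg Q (ρ := ρ) he
    have key := MoranFamily.half_div_lt_div_sub (η := β' * κ) (D := -D)
      (p := -∫ l, Real.log (l.2 (M.m' D l)) ∂(Q.prod ρ)) (by positivity) hneg
      (M.log_A_le_integral_log_a Q he) ?_
    · refine key.trans_eq ?_
      rw [MoranFamily.G', neg_div]
      ring
    rw [neg_mul, ← M.integral_log_naturalWeight Q hD₀ hD0 he, neg_sub_neg, ← integral_sub
      (MoranFamily.integrable_log_weight Q hρ he) (M.integrable_log_naturalWeight Q hD₀ he)]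
    have hcross : ∀ᵐ l ∂(Q.prod ρ), ∀ j, l.2 j * M.naturalWeight D (M.m' D l) l.1 ≤
        l.2 (M.m' D l) * M.naturalWeight D j l.1 := by
      filter_upwards [hpos] with l hl j
      have := M.naturalWeight_mul_le_of_ratio_le (hl _) (hl _) (M.ratio_m'_le_ratio D l j)
      linarith
    refine MoranFamily.mul_le_integral_of_le_on ((MoranFamily.integrable_log_weight Q hρ he).sub
      (M.integrable_log_naturalWeight Q hD₀ he)) ?_ hβ'.le ?_ hmis
    · filter_upwards [hcross] with l hcr
      exact sub_nonneg.2 (Real.log_le_log (M.naturalWeight_pos D _ _)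
        (cross_mul_le (M.sum_naturalWeight D l.1) l.2.2.2 hcr i).2)
    · filter_upwards [hpos, hcross] with l hl hcr
      have hq := M.naturalWeight_pos D (M.m' D l) l.1
      have hm := hl (M.m' D l)
      rintro (⟨hu, hv⟩ | ⟨hu, hv⟩)
      · refine (min_le_right _ _).trans
          (log_div_le_log_sub_log (by linarith) (by linarith) hq ?_)
        have h1 : (1 - l.2 i) * M.naturalWeight D (M.m' D l) l.1 ≤
            l.2 (M.m' D l) * (1 - M.naturalWeight D i l.1) :=
          (cross_mul_le (M.sum_naturalWeight D l.1) l.2.2.2 hcr i).1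
        have h2 := hle₂ _ hu
        have h3 : l.2 (M.m' D l) * (1 - M.naturalWeight D i l.1) ≤
          l.2 (M.m' D l) * (1 - c₂) := by gcongr
        refine le_trans ?_ (h1.trans h3)
        gcongr
      · refine (min_le_left _ _).trans (log_div_le_log_sub_log hc₁pos hc hq ?_)
        have h1 := hcr i
        have h2 := hle₁ _ hu
        nlinarith
  refine ⟨hG, hG', ?_⟩
  filter_upwards [M.ae_phiDim_of_digit Q hρ (M.measurable_m D),
    M.ae_phiDim_of_digit Q hρ (M.measurable_m' D)] with l hl hl' Φ hΦ _
  exact ⟨lt_of_lt_of_le (EReal.coe_lt_coe_iff.2 (lt_sub_iff_add_lt'.1 hG)) (hl Φ hΦ).1,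
    lt_of_le_of_lt (hl' Φ hΦ).2 (EReal.coe_lt_coe_iff.2 (lt_sub_comm.1 hG'))⟩
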